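/- Let $n\ge 3$ and let $\mathrm{PD}(n)$ be the set of real symmetric positive definite $n\times n$ matrices, with $\langle A,B\rangle=\mathrm{tr}(AB^\top)$ and $\|A\|_F=\sqrt{\langle A,A\rangle}$. A *potential* is a strictly convex, decreasing, three times continuously differentiable function $V:(0,\infty)\to\mathbb{R}$ such that the functions $\nu(z)=-zV'(z)$ and $\beta(z)=z\nu'(z)/\nu(z)$ satisfy $\nu(z)>0$ and $\beta(z)<1/n$ for all $z>0$, and $\lim_{z\to+0} z/\nu(z)^{n-1}=0$. For $P,Q\in\mathrm{PD}(n)$ let $$D_V(P,Q)=\varphi(P)-\varphi(Q)-\langle\nabla\varphi(Q),P-Q\rangle,\qquad \varphi(A)=V(\det A),$$ where $\nabla\varphi(Q)$ is the matrix with entries $\partial\varphi/\partial Q_{ij}(Q)$. Let $s,y\in\mathbb{R}^n$ satisfy $s^\top y>0$, and let $\mathcal{Y}\subset\mathbb{R}^n$ be a bounded set containing a vector that is linearly independent of $y$ (this holds, for example, if $\mathcal{Y}$ contains a non-empty open set). For $H_k\in\mathrm{PD}(n)$, $\bar y\in\mathcal{Y}$ and $\varepsilon\in\mathbb{R}$ near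 $0$, let $H(\varepsilon)$ be the optimal solution of the problem ($V$-DFP-H) $$\min_{H\in\mathrm{PD}(n)} D_V(H,H_k)\quad\text{subject to}\quad H(y+\varepsilon\bar y)=(1+\varepsilon)s .$$ Then, for every potential $V$, all $H_k\in\mathrm{PD}(n)$ and all $\bar y\in\mathcal{Y}$, the optimal solution $H(\varepsilon)$ exists and is unique for all $\varepsilon$ sufficiently close to $0$, the influence function $\dot H(0)=\lim_{\varepsilon\to0}(H(\varepsilon)-H(0))/\varepsilon$ exists, and the gross error sensitivity is infinite: $$\sup\{\|\dot H(0)\|_F \mid H_k\in\mathrm{PD}(n),\ \bar y\in\mathcal{Y}\}=\infty .$$ -/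

import Mathlib

open Filter Topology

noncomputable section

namespace QuasiNewton

/-- `ν_V(z) = -z V'(z)`. -/
def nu (V : ℝ → ℝ) (z : ℝ) : ℝ := -z * deriv V z

/-- `β_V(z) = z ν_V'(z) / ν_V(z)`. -/
def beta (V : ℝ → ℝ) (z : ℝ) : ℝ := z * deriv (nu V) z / nu V z

/-- Potential functions on the positive reals, for `n × n` matrices.
Only the values of `V` on `(0, ∞)` matter. -/
structure IsPotential (n : ℕ) (V : ℝ → ℝ) : Prop where
  strictConvexOn : StrictConvexOn ℝ (Set.Ioi 0) V
  antitoneOn : AntitoneOn V (Set.Ioi 0)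
  contDiffOn : ContDiffOn ℝ 3 V (Set.Ioi 0)
  nu_pos : ∀ z : ℝ, 0 < z → 0 < nu V z
  beta_lt : ∀ z : ℝ, 0 < z → beta V z < 1 / (n : ℝ)
  tendsto_zero : Tendsto (fun z : ℝ => z / nu V z ^ (n - 1)) (𝓝[>] 0) (𝓝 0)

/-- The matrix of the partial derivatives of `φ` at `Q` with respect to the `n²` entries. -/
def matrixGradient {n : ℕ} (φ : Matrix (Fin n) (Fin n) ℝ → ℝ) (Q : Matrix (Fin n) (Fin n) ℝ) :
    Matrix (Fin n) (Fin n) ℝ :=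
  Matrix.of fun i j => deriv (fun t : ℝ => φ (Q + t • Matrix.single i j (1 : ℝ))) 0

/-- The Bregman divergence `φ(P) - φ(Q) - ⟨∇φ(Q), P - Q⟩`, where `⟨A, B⟩ = tr(A Bᵀ)`. -/
def bregmanDiv {n : ℕ} (φ : Matrix (Fin n) (Fin n) ℝ → ℝ) (P Q : Matrix (Fin n) (Fin n) ℝ) : ℝ :=
  φ P - φ Q - (matrixGradient φ Q * (P - Q).transpose).trace

/-- The `V`-Bregman divergence `D_V(P, Q)`: the one induced by `P ↦ V (det P)`. -/
def vBregmanDiv {n : ℕ} (V : ℝ → ℝ) (P Q : Matrix (Fin n) (Fin n) ℝ) : ℝ :=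
  bregmanDiv (fun A => V A.det) P Q

/-- `H` is an optimal solution of the perturbed `V`-DFP problem for the inverse Hessian:
minimize `D_V(H, Hk)` over positive definite `H` with `H (y + ε ybar) = (1 + ε) s`. -/
structure IsVDFPHSolution {n : ℕ} (V : ℝ → ℝ) (Hk : Matrix (Fin n) (Fin n) ℝ)
    (s y ybar : Fin n → ℝ) (ε : ℝ) (H : Matrix (Fin n) (Fin n) ℝ) : Prop where
  posDef : H.PosDef
  secant : H.mulVec (y + ε • ybar) = (1 + ε) • s
  le_of_feasible : ∀ H' : Matrix (Fin n) (Fin n) ℝ, H'.PosDef →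
    H'.mulVec (y + ε • ybar) = (1 + ε) • s → vBregmanDiv V H Hk ≤ vBregmanDiv V H' Hk

/-- `D` is the influence function of the `V`-DFP-H update: for all `ε` near `0` the perturbed
problem has exactly one optimal solution `H ε`, and `D = lim_{ε → 0} (H ε - H 0) / ε`. -/
def IsInfluenceVDFPH {n : ℕ} (V : ℝ → ℝ) (Hk : Matrix (Fin n) (Fin n) ℝ)
    (s y ybar : Fin n → ℝ) (D : Matrix (Fin n) (Fin n) ℝ) : Prop :=
  ∃ H : ℝ → Matrix (Fin n) (Fin n) ℝ,
    (∀ᶠ ε in 𝓝 (0 : ℝ), IsVDFPHSolution V Hk s y ybar ε (H ε) ∧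
      ∀ H' : Matrix (Fin n) (Fin n) ℝ, IsVDFPHSolution V Hk s y ybar ε H' → H' = H ε) ∧
    Tendsto (fun ε : ℝ => ε⁻¹ • (H ε - H 0)) (𝓝[≠] 0) (𝓝 D)

/-- The Frobenius norm `‖A‖_F = √(tr(A Aᵀ))`. -/
def frobNorm {n : ℕ} (A : Matrix (Fin n) (Fin n) ℝ) : ℝ :=
  Real.sqrt (A * A.transpose).trace

/-- The gross error sensitivity of the `V`-DFP-H update: the supremum, in the extended reals,
of the Frobenius norms of the influence functions over `Hk ∈ ℋ` and `ybar ∈ 𝒴`. -/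
def grossErrorSensitivityVDFPH {n : ℕ} (V : ℝ → ℝ) (s y : Fin n → ℝ)
    (ℋ : Set (Matrix (Fin n) (Fin n) ℝ)) (𝒴 : Set (Fin n → ℝ)) : EReal :=
  sSup {r : EReal | ∃ Hk ∈ ℋ, ∃ ybar ∈ 𝒴, ∃ D : Matrix (Fin n) (Fin n) ℝ,
    IsInfluenceVDFPH V Hk s y ybar D ∧ r = (frobNorm D : EReal)}

end QuasiNewton

end

/-! Write `K` for the starting matrix, `u` for the perturbed `y` and `w` for the perturbed `s`. The
minimizer is a `dfpFamily` matrix `H` whose parameter `t` solves `ν(det H) = ν(det K) t`. Since `det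
H` is a constant times `t ^ (n - 1)`, this is a scalar equation `z / ν(z) ^ (n - 1) = a`, and the
conditions on a potential make it solvable with differentiable dependence on `a`.

Optimality is Pythagorean: for feasible `H'`, `D(H', K) = D(H, K) + D(H', H)`
(`trace_dfpFamily_inv_mul`), and the divergence of distinct matrices is positive by AM-GM for
eigenvalues together with convexity of `x ↦ V (x ^ n)`. Every term of `H` is differentiable in `ε`,
so the influence function `D` exists.

Differentiating the secant equation gives `D y = s - H(0) ybar`. If `K` already maps `y` to `s`,
then `H(0) = K`. Such `K` can still be arbitrarily large on the part of `ybar` orthogonal to `y`, so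
`D y`, and hence `D`, is unbounded. -/

noncomputable section

namespace QuasiNewton

/-! ### Scalar analysis of the potential. -/

namespace IsPotential

variable {n : ℕ} {V : ℝ → ℝ}

theorem differentiableAt (hV : IsPotential n V) {z : ℝ} (hz : 0 < z) : DifferentiableAt ℝ V z :=
  (hV.contDiffOn.contDiffAt (Ioi_mem_nhds hz)).differentiableAt (by norm_num)

theorem contDiffAt_nu (hV : IsPotential n V) {z : ℝ} (hz : 0 < z) : ContDiffAt ℝ 2 (nu V) z := by
  have h : ContDiffAt ℝ 2 (deriv V) z :=
    ((hV.contDiffOn.deriv_of_isOpen isOpen_Ioi (m := 2) (by norm_num)).contDiffAt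
      (Ioi_mem_nhds hz))
  exact contDiffAt_id.neg.mul h

theorem differentiableAt_nu (hV : IsPotential n V) {z : ℝ} (hz : 0 < z) :
    DifferentiableAt ℝ (nu V) z :=
  (hV.contDiffAt_nu hz).differentiableAt (by norm_num)

theorem mul_deriv_nu_lt (hV : IsPotential n V) (hn : 0 < n) {z : ℝ} (hz : 0 < z) :
    n * (z * deriv (nu V) z) < nu V z := by
  have h := hV.beta_lt z hz
  have hn' : (0 : ℝ) < n := by exact_mod_cast hn
  rw [beta, div_lt_div_iff₀ (hV.nu_pos z hz) hn'] at h
  linarith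

/-- The function `z ↦ ν(z)ⁿ / z` is strictly decreasing. -/
theorem strictAntiOn_nu_pow_div (hV : IsPotential n V) (hn : 0 < n) :
    StrictAntiOn (fun z => nu V z ^ n / z) (Set.Ioi 0) := by
  have hd : ∀ z : ℝ, 0 < z → HasDerivAt (fun z => nu V z ^ n / z)
      ((n * nu V z ^ (n - 1) * deriv (nu V) z * z - nu V z ^ n * 1) / z ^ 2) z := fun z hz =>
    ((hV.differentiableAt_nu hz).hasDerivAt.pow n).div (hasDerivAt_id z) hz.ne'
  refine strictAntiOn_of_deriv_neg (convex_Ioi 0)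
    (fun z hz => (hd z hz).continuousAt.continuousWithinAt) fun z hz => ?_
  rw [interior_Ioi] at hz
  have hz : 0 < z := hz
  rw [(hd z hz).deriv]
  refine div_neg_of_neg_of_pos ?_ (by positivity)
  have h1 := hV.mul_deriv_nu_lt hn hz
  have h2 : nu V z ^ n = nu V z ^ (n - 1) * nu V z := by
    rw [← pow_succ, Nat.sub_add_cancel hn]
  have h3 : 0 < nu V z ^ (n - 1) := pow_pos (hV.nu_pos z hz) _
  rw [h2]
  nlinarith [mul_lt_mul_of_pos_left h1 h3]

/-- An `n`-th root of the previous monotonicity. Up to the factor `-n` this function is the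
derivative of `x ↦ V (x ^ n)`, so it encodes strict convexity. -/
theorem strictAntiOn_nu_comp_pow_div (hV : IsPotential n V) (hn : 0 < n) :
    StrictAntiOn (fun x => nu V (x ^ n) / x) (Set.Ioi 0) := by
  intro a (ha : 0 < a) b (hb : 0 < b) hab
  have h := hV.strictAntiOn_nu_pow_div hn (Set.mem_Ioi.2 (pow_pos ha n))
    (Set.mem_Ioi.2 (pow_pos hb n)) (pow_lt_pow_left₀ hab ha.le hn.ne')
  simp only [← div_pow] at h
  exact lt_of_pow_lt_pow_left₀ n (div_pos (hV.nu_pos _ (pow_pos ha n)) ha).le h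

/-- The tangent inequality for the strictly convex function `x ↦ V(xⁿ)`. -/
theorem tangent_lt (hV : IsPotential n V) (hn : 0 < n) {a x : ℝ} (ha : 0 < a) (hx : 0 < x)
    (hxa : x ≠ a) : 0 < V (x ^ n) - V (a ^ n) + nu V (a ^ n) * (n * (x / a) - n) := by
  have hd : ∀ z : ℝ, 0 < z → HasDerivAt (fun z => V (z ^ n)) (-n * (nu V (z ^ n) / z)) z := by
    intro z hz
    have h := (hV.differentiableAt (pow_pos hz n)).hasDerivAt.comp z (hasDerivAt_pow n z)
    refine h.congr_deriv ?_
    have h2 : z ^ n = z ^ (n - 1) * z := by rw [← pow_succ, Nat.sub_add_cancel hn]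
    rw [nu]
    field_simp
    rw [h2]; ring
  have hn' : (0 : ℝ) < n := by exact_mod_cast hn
  have hK := hV.strictAntiOn_nu_comp_pow_div hn
  have key : nu V (a ^ n) * (n * (x / a) - n) = n * (nu V (a ^ n) / a) * (x - a) := by
    field_simp
  rw [key]
  rcases lt_or_gt_of_ne hxa with h | h
  · obtain ⟨ξ, hξ, he⟩ := exists_hasDerivAt_eq_slope (fun z => V (z ^ n))
      (fun z => -n * (nu V (z ^ n) / z)) h
      (fun z hz => (hd z (hx.trans_le hz.1)).continuousAt.continuousWithinAt)
      (fun z hz => hd z (hx.trans hz.1))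
    have h1 : nu V (a ^ n) / a < nu V (ξ ^ n) / ξ :=
      hK (Set.mem_Ioi.2 (hx.trans hξ.1)) (Set.mem_Ioi.2 ha) hξ.2
    rw [eq_div_iff (sub_pos.2 h).ne'] at he
    nlinarith [mul_lt_mul_of_pos_left h1 (mul_pos hn' (sub_pos.2 h))]
  · obtain ⟨ξ, hξ, he⟩ := exists_hasDerivAt_eq_slope (fun z => V (z ^ n))
      (fun z => -n * (nu V (z ^ n) / z)) h
      (fun z hz => (hd z (ha.trans_le hz.1)).continuousAt.continuousWithinAt)
      (fun z hz => hd z (ha.trans hz.1))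
    have h1 : nu V (ξ ^ n) / ξ < nu V (a ^ n) / a :=
      hK (Set.mem_Ioi.2 ha) (Set.mem_Ioi.2 (ha.trans hξ.1)) hξ.1
    rw [eq_div_iff (sub_pos.2 h).ne'] at he
    nlinarith [mul_lt_mul_of_pos_left h1 (mul_pos hn' (sub_pos.2 h))]

/-- The sign of the derivative is that of `ν - (n - 1) z ν'`, positive because `n z ν' < ν`. Being
nonzero, it permits the inverse function theorem. -/
theorem exists_hasStrictDerivAt_div_nu_pow (hV : IsPotential n V) (hn : 0 < n) {z : ℝ}
    (hz : 0 < z) :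
    ∃ d : ℝ, d ≠ 0 ∧ HasStrictDerivAt (fun z => z / nu V z ^ (n - 1)) d z := by
  have hν := hV.nu_pos z hz
  have h1 : HasStrictDerivAt (nu V) (deriv (nu V) z) z :=
    (hV.contDiffAt_nu hz).hasStrictDerivAt (by norm_num)
  refine ⟨_, ?_, (hasStrictDerivAt_id z).div (h1.pow (n - 1)) (pow_pos hν _).ne'⟩
  refine (div_pos ?_ (by positivity)).ne'
  simp only [id, one_mul]
  have h2 := hV.mul_deriv_nu_lt hn hz
  -- The power rule yields the truncated exponent `n - 1 - 1`, so `n = 1` is treated apart.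
  have h3 : nu V z ^ (n - 1) * nu V z = nu V z ^ (n - 1 - 1) * nu V z * nu V z ∨ n - 1 = 0 := by
    by_cases h : n - 1 = 0
    · exact Or.inr h
    · left
      rw [← pow_succ (nu V z) (n - 1 - 1), Nat.sub_add_cancel (Nat.one_le_iff_ne_zero.2 h)]
  rcases h3 with h3 | h3
  · have h4 : nu V z ^ (n - 1) = nu V z ^ (n - 1 - 1) * nu V z :=
      mul_right_cancel₀ hν.ne' h3
    have h5 : 0 < nu V z ^ (n - 1 - 1) := pow_pos hν _
    have h6 : ((n - 1 : ℕ) : ℝ) * (z * deriv (nu V) z) < nu V z := by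
      rw [Nat.cast_sub hn, Nat.cast_one]
      have hn' : (1 : ℝ) ≤ n := by exact_mod_cast hn
      rcases le_total 0 (z * deriv (nu V) z) with h | h
      · nlinarith
      · nlinarith [mul_nonneg (sub_nonneg.2 hn') (neg_nonneg.2 h)]
    rw [h4]
    nlinarith [mul_lt_mul_of_pos_left h6 h5]
  · simp [h3]

/-- The `n`-th power equals `z / (ν(z) ^ n / z) ^ (n - 1)`, and the decreasing `ν ^ n / z` is
bounded for `z ≥ 1` by its value at `1`. -/
theorem tendsto_div_nu_pow_atTop (hV : IsPotential n V) (hn : 0 < n) :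
    Tendsto (fun z => z / nu V z ^ (n - 1)) atTop atTop := by
  have h1 : ∀ z : ℝ, 1 ≤ z → z / nu V 1 ^ (n * (n - 1)) ≤ (z / nu V z ^ (n - 1)) ^ n := by
    intro z hz1
    have hz : 0 < z := by linarith
    have hν := hV.nu_pos z hz
    have h := (hV.strictAntiOn_nu_pow_div hn).antitoneOn (Set.mem_Ioi.2 one_pos)
      (Set.mem_Ioi.2 hz) hz1
    simp only [div_one] at h
    have h' := pow_le_pow_left₀ (by positivity) h (n - 1)
    have e : (z / nu V z ^ (n - 1)) ^ n = z / (nu V z ^ n / z) ^ (n - 1) := by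
      have h2 : z ^ n = z ^ (n - 1) * z := by rw [← pow_succ, Nat.sub_add_cancel hn]
      rw [div_pow, div_pow, h2, ← pow_mul, ← pow_mul, mul_comm n]
      field_simp
    rw [e, pow_mul]
    exact div_le_div_of_nonneg_left hz.le (by positivity) h'
  have h2 : Tendsto (fun z => (z / nu V z ^ (n - 1)) ^ n) atTop atTop := by
    refine tendsto_atTop_mono' _ ((eventually_ge_atTop 1).mono h1) ?_
    exact tendsto_id.atTop_div_const (pow_pos (hV.nu_pos 1 one_pos) _)
  refine tendsto_atTop.2 fun b => ?_
  filter_upwards [(tendsto_atTop.1 h2) ((max b 0) ^ n + 1), eventually_gt_atTop 0] with z hz hz0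
  have hp : 0 ≤ z / nu V z ^ (n - 1) := (div_pos hz0 (pow_pos (hV.nu_pos z hz0) _)).le
  have := lt_of_pow_lt_pow_left₀ n hp (by linarith : (max b 0) ^ n < _)
  exact (le_max_left _ _).trans this.le

theorem exists_div_nu_pow_eq (hV : IsPotential n V) (hn : 0 < n) {a : ℝ} (ha : 0 < a) :
    ∃ z : ℝ, 0 < z ∧ z / nu V z ^ (n - 1) = a := by
  have hc : ContinuousOn (fun z => z / nu V z ^ (n - 1)) (Set.Ioi 0) := fun z hz => by
    obtain ⟨d, -, hd⟩ := hV.exists_hasStrictDerivAt_div_nu_pow hn hz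
    exact hd.hasDerivAt.continuousAt.continuousWithinAt
  obtain ⟨z₁, h1, h1'⟩ := ((hV.tendsto_zero.eventually (gt_mem_nhds ha)).and
    self_mem_nhdsWithin).exists
  obtain ⟨z₂, h2, h2'⟩ := (((hV.tendsto_div_nu_pow_atTop hn).eventually_gt_atTop a).and
    (eventually_gt_atTop (0 : ℝ))).exists
  obtain ⟨z, hz, he⟩ := isPreconnected_Ioi.intermediate_value h1' h2' hc ⟨h1.le, h2.le⟩
  exact ⟨z, hz, he⟩

/-- A differentiable local solution of the scalar equation `z / ν(z)ⁿ⁻¹ = a`. -/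
theorem exists_local_solution (hV : IsPotential n V) (hn : 0 < n) {a : ℝ} (ha : 0 < a) :
    ∃ g : ℝ → ℝ, DifferentiableAt ℝ g a ∧ 0 < g a ∧
      ∀ᶠ b in 𝓝 a, 0 < g b ∧ g b / nu V (g b) ^ (n - 1) = b := by
  obtain ⟨z, hz, rfl⟩ := hV.exists_div_nu_pow_eq hn ha
  obtain ⟨d, hd0, hd⟩ := hV.exists_hasStrictDerivAt_div_nu_pow hn hz
  have hdiff := (hd.to_localInverse hd0).hasDerivAt.differentiableAt
  have hga : hd.localInverse _ _ _ hd0 (z / nu V z ^ (n - 1)) = z :=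
    (hd.eventually_left_inverse hd0).self_of_nhds
  refine ⟨hd.localInverse _ _ _ hd0, hdiff, hga.symm ▸ hz, ?_⟩
  filter_upwards [hd.eventually_right_inverse hd0,
    hdiff.continuousAt.eventually (lt_mem_nhds (hga.symm ▸ hz))] with b h1 h2
  exact ⟨h2, h1⟩

end IsPotential

/-! ### The divergence: trace formula and positivity. -/

open Matrix

variable {n : ℕ} {V : ℝ → ℝ}

theorem det_add_smul_single (Q : Matrix (Fin n) (Fin n) ℝ) (i j : Fin n) (t : ℝ) :
    (Q + t • Matrix.single i j (1 : ℝ)).det = Q.det + t * Q.adjugate j i := by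
  have h : Q + t • Matrix.single i j (1 : ℝ) = Q.updateRow i (Q i + t • Pi.single j 1) := by
    ext k l
    by_cases hk : k = i
    · subst hk
      by_cases hl : l = j
      · subst hl; simp
      · simp [hl, Ne.symm hl]
    · simp [hk, Ne.symm hk]
  rw [h, det_updateRow_add, det_updateRow_smul, updateRow_eq_self, adjugate_apply]

theorem matrixGradient_comp_det {Q : Matrix (Fin n) (Fin n) ℝ} (hV : DifferentiableAt ℝ V Q.det) :
    matrixGradient (fun A => V A.det) Q = deriv V Q.det • Q.adjugateᵀ := by
  ext i j
  have h1 : HasDerivAt (fun t : ℝ => Q.det + t * Q.adjugate j i) (Q.adjugate j i) 0 := by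
    simpa using ((hasDerivAt_id (0 : ℝ)).mul_const (Q.adjugate j i)).const_add Q.det
  have h2 : HasDerivAt V (deriv V Q.det) (Q.det + 0 * Q.adjugate j i) := by
    simpa using hV.hasDerivAt
  simp only [matrixGradient, of_apply, det_add_smul_single, Matrix.smul_apply, transpose_apply,
    smul_eq_mul]
  exact (h2.comp 0 h1).deriv

theorem vBregmanDiv_eq (hV : IsPotential n V) (P : Matrix (Fin n) (Fin n) ℝ)
    {Q : Matrix (Fin n) (Fin n) ℝ} (hQ : Q.PosDef) :
    vBregmanDiv V P Q = V P.det - V Q.det + nu V Q.det * ((Q⁻¹ * P).trace - n) := by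
  have hd := hQ.det_pos
  have hadj : Q.adjugate = Q.det • Q⁻¹ := by
    rw [inv_def, Ring.inverse_eq_inv', smul_smul, mul_inv_cancel₀ hd.ne', one_smul]
  rw [vBregmanDiv, bregmanDiv, matrixGradient_comp_det (hV.differentiableAt hd), smul_mul_assoc,
    trace_smul, ← transpose_mul, trace_transpose, trace_mul_comm, hadj, smul_mul_assoc, trace_smul,
    mul_sub, nonsing_inv_mul _ hd.ne'.isUnit, trace_sub, trace_one, nu]
  simp only [smul_eq_mul, Fintype.card_fin]
  ring

/-- The inequality of arithmetic and geometric means for the eigenvalues of a positive definite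
matrix, with its case of equality. -/
theorem card_mul_le_trace {C : Matrix (Fin n) (Fin n) ℝ} (hC : C.PosDef) {μ : ℝ}
    (hμ : 0 < μ) (hdet : C.det = μ ^ n) :
    n * μ ≤ C.trace ∧ (C.trace = n * μ → C = μ • 1) := by
  set e := hC.1.eigenvalues with he
  have hpos : ∀ i, 0 < e i := hC.eigenvalues_pos
  have htr : C.trace = ∑ i, e i := by simpa using hC.1.trace_eq_sum_eigenvalues
  have hd : ∏ i, e i = μ ^ n := by rw [← hdet]; simpa using hC.1.det_eq_prod_eigenvalues.symm
  -- As the logarithms cancel, `tr C / μ - n` is a sum of terms `x - 1 - log x ≥ 0`, each vanishing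
  -- only at `x = 1`.
  have hlog : ∑ i, Real.log (e i / μ) = 0 := by
    rw [← Real.log_prod (fun i _ => (div_pos (hpos i) hμ).ne'), Finset.prod_div_distrib, hd]
    simp [hμ.ne']
  have hsum : ∑ i, (e i / μ - 1 - Real.log (e i / μ)) = C.trace / μ - n := by
    rw [Finset.sum_sub_distrib, hlog, Finset.sum_sub_distrib, ← Finset.sum_div, htr]
    simp
  have hnn : ∀ i ∈ Finset.univ, 0 ≤ e i / μ - 1 - Real.log (e i / μ) := fun i _ => by
    linarith [Real.log_le_sub_one_of_pos (div_pos (hpos i) hμ)]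
  constructor
  · have := Finset.sum_nonneg hnn
    rw [hsum, sub_nonneg, le_div_iff₀ hμ] at this
    exact this
  · intro h
    rw [h, mul_div_cancel_right₀ _ hμ.ne', sub_self, Finset.sum_eq_zero_iff_of_nonneg hnn] at hsum
    have hall : e = fun _ => μ := by
      funext i
      by_contra hne
      have h1 : e i / μ ≠ 1 := fun h1 => hne ((div_eq_one_iff_eq hμ.ne').1 h1)
      have := Real.log_lt_sub_one_of_pos (div_pos (hpos i) hμ) h1
      linarith [hsum i (Finset.mem_univ i)]
    have hs := hC.1.spectral_theorem
    rw [← he, hall] at hs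
    have : diagonal (RCLike.ofReal ∘ fun _ : Fin n => μ) = μ • (1 : Matrix (Fin n) (Fin n) ℝ) := by
      ext i j; simp [diagonal_apply, one_apply]
    rw [this, map_smul, map_one] at hs
    exact hs

-- Factoring `Q⁻¹ = Bᵀ B` and conjugating `P` by `B` reduces to the case `Q = 1`.
open scoped MatrixOrder Matrix.Norms.L2Operator in
theorem card_mul_le_trace_inv_mul {P Q : Matrix (Fin n) (Fin n) ℝ} (hP : P.PosDef)
    (hQ : Q.PosDef) {μ : ℝ} (hμ : 0 < μ) (hdet : P.det = μ ^ n * Q.det) :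
    n * μ ≤ (Q⁻¹ * P).trace ∧ ((Q⁻¹ * P).trace = n * μ → P = μ • Q) := by
  obtain ⟨B, hB, hBQ⟩ : ∃ B : Matrix (Fin n) (Fin n) ℝ, IsUnit B ∧ Q⁻¹ = Bᵀ * B := by
    obtain ⟨B, hB⟩ := CStarAlgebra.nonneg_iff_eq_star_mul_self.mp hQ.inv.posSemidef.nonneg
    rw [star_eq_conjTranspose, conjTranspose_eq_transpose_of_trivial] at hB
    refine ⟨B, (isUnit_iff_isUnit_det B).2 (isUnit_iff_ne_zero.2 fun h => ?_), hB⟩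
    have := hQ.inv.det_pos.ne'
    rw [hB, det_mul, h, mul_zero] at this
    exact this rfl
  have hBd : IsUnit B.det := (isUnit_iff_isUnit_det B).1 hB
  have hC : (B * P * Bᵀ).PosDef := by
    have := hP.mul_mul_conjTranspose_same (B := B)
      (vecMul_injective_iff_isUnit.2 hB)
    rwa [conjTranspose_eq_transpose_of_trivial] at this
  have htr : (Q⁻¹ * P).trace = (B * P * Bᵀ).trace := by
    rw [hBQ, mul_assoc, trace_mul_comm]
  have hQd := hQ.det_pos.ne'
  have hdQ : B.det * B.det * Q.det = 1 := by
    have h : (Q⁻¹ * Q).det = 1 := by rw [nonsing_inv_mul _ hQd.isUnit, det_one]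
    rwa [hBQ, det_mul, det_mul, det_transpose] at h
  have hCd : (B * P * Bᵀ).det = μ ^ n := by
    rw [det_mul, det_mul, det_transpose, hdet]
    linear_combination μ ^ n * hdQ
  obtain ⟨h1, h2⟩ := card_mul_le_trace hC hμ hCd
  rw [htr]
  refine ⟨h1, fun h => ?_⟩
  have h3 := h2 h
  have hQB : Q = B⁻¹ * Bᵀ⁻¹ := by
    rw [← Matrix.mul_inv_rev, ← hBQ, nonsing_inv_nonsing_inv _ hQd.isUnit]
  have hBt : IsUnit Bᵀ.det := by rwa [det_transpose]
  calc P = B⁻¹ * (B * P * Bᵀ) * Bᵀ⁻¹ := by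
        rw [mul_assoc B, nonsing_inv_mul_cancel_left _ _ hBd, mul_nonsing_inv_cancel_right _ _ hBt]
    _ = μ • Q := by rw [h3, hQB]; simp

/-- With `x`, `a` the `n`-th roots of the determinants, AM-GM bounds the trace below by `n x / a`.
Strictness comes from the tangent inequality if `x ≠ a`, and from the equality case of AM-GM if `x =
a`. -/
theorem vBregmanDiv_pos (hV : IsPotential n V) (hn : 0 < n) {P Q : Matrix (Fin n) (Fin n) ℝ}
    (hP : P.PosDef) (hQ : Q.PosDef) (hne : P ≠ Q) : 0 < vBregmanDiv V P Q := by
  have root : ∀ d : ℝ, 0 < d → ∃ x : ℝ, 0 < x ∧ x ^ n = d := fun d hd =>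
    ⟨d ^ (n : ℝ)⁻¹, Real.rpow_pos_of_pos hd _, Real.rpow_inv_natCast_pow hd.le hn.ne'⟩
  obtain ⟨x, hx, hxP⟩ := root _ hP.det_pos
  obtain ⟨a, ha, haQ⟩ := root _ hQ.det_pos
  have hdet : P.det = (x / a) ^ n * Q.det := by
    rw [← hxP, ← haQ, div_pow, div_mul_cancel₀ _ (pow_pos ha n).ne']
  obtain ⟨h1, h2⟩ := card_mul_le_trace_inv_mul hP hQ (div_pos hx ha) hdet
  have hν := hV.nu_pos _ hQ.det_pos
  rw [vBregmanDiv_eq hV P hQ]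
  by_cases hxa : x = a
  · subst hxa
    rw [div_self hx.ne', mul_one] at h1
    rw [div_self hx.ne', mul_one, one_smul] at h2
    have h3 : (n : ℝ) < (Q⁻¹ * P).trace := lt_of_le_of_ne h1 fun h => hne (h2 h.symm)
    rw [← hxP, ← haQ, sub_self, zero_add, haQ]
    exact mul_pos hν (sub_pos.2 h3)
  · have h3 := hV.tangent_lt hn ha hx hxa
    rw [hxP, haQ] at h3
    have h4 := mul_le_mul_of_nonneg_left h1 hν.le
    linarith

theorem vBregmanDiv_self (V : ℝ → ℝ) (Q : Matrix (Fin n) (Fin n) ℝ) : vBregmanDiv V Q Q = 0 := by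
  simp [vBregmanDiv, bregmanDiv]

/-! ### The candidate minimizers. -/

/-- The family of matrices `w wᵀ / (w·u) + t (K - (K u)(K u)ᵀ / (u·K u))`. -/
def dfpFamily (K : Matrix (Fin n) (Fin n) ℝ) (u w : Fin n → ℝ) (t : ℝ) :
    Matrix (Fin n) (Fin n) ℝ :=
  (w ⬝ᵥ u)⁻¹ • vecMulVec w w + t • (K - (u ⬝ᵥ K *ᵥ u)⁻¹ • vecMulVec (K *ᵥ u) (K *ᵥ u))

section dfpFamily

variable {K : Matrix (Fin n) (Fin n) ℝ} {u w : Fin n → ℝ} {t : ℝ}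

theorem dfpFamily_mulVec (hw : w ⬝ᵥ u ≠ 0) (hq : u ⬝ᵥ K *ᵥ u ≠ 0) :
    dfpFamily K u w t *ᵥ u = w := by
  simp only [dfpFamily, add_mulVec, smul_mulVec, sub_mulVec, vecMulVec_mulVec,
    op_smul_eq_smul, smul_smul, dotProduct_comm (K *ᵥ u) u, inv_mul_cancel₀ hw,
    inv_mul_cancel₀ hq, one_smul, sub_self, smul_zero, add_zero]

/-- A congruence by a scaled rank-one perturbation of the identity, from which determinant and
positive definiteness can be read off. -/
theorem exists_dfpFamily_eq_conj (hK : K.IsSymm) (hw : 0 < w ⬝ᵥ u) (hq : 0 < u ⬝ᵥ K *ᵥ u)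
    (ht : 0 < t) :
    ∃ X : Matrix (Fin n) (Fin n) ℝ, dfpFamily K u w t = X * K * Xᵀ ∧
      X.det = Real.sqrt t ^ n * Real.sqrt (w ⬝ᵥ u / (t * (u ⬝ᵥ K *ᵥ u))) := by
  set p := w ⬝ᵥ u with hpd
  set q := u ⬝ᵥ K *ᵥ u with hqd
  set σ := Real.sqrt t
  set ρ := Real.sqrt (p / (t * q))
  have hσ : σ ^ 2 = t := Real.sq_sqrt ht.le
  have hρ : ρ ^ 2 = p / (t * q) := Real.sq_sqrt (by positivity)
  have hσ0 : 0 < σ := Real.sqrt_pos.2 ht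
  -- The `q⁻¹` term cancels the mixed products of `w` and `K u`; the value of `ρ` makes the
  -- coefficient of `w wᵀ` equal to `p⁻¹`.
  set r : Fin n → ℝ := (ρ / p) • w - q⁻¹ • K *ᵥ u with hr
  refine ⟨σ • (1 + vecMulVec r u), ?_, ?_⟩
  · have huK : u ᵥ* K = K *ᵥ u := by rw [← mulVec_transpose, hK.eq]
    have e : (σ • (1 + vecMulVec r u)) * K * (σ • (1 + vecMulVec r u))ᵀ
        = t • (K + vecMulVec r (K *ᵥ u) + vecMulVec (K *ᵥ u) r + q • vecMulVec r r) := by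
      rw [transpose_smul, transpose_add, transpose_one, transpose_vecMulVec, smul_mul_assoc,
        smul_mul_assoc, mul_smul_comm, smul_smul, ← pow_two, hσ, add_mul, one_mul, vecMulVec_mul,
        huK, mul_add, mul_one, add_mul, mul_vecMulVec, vecMulVec_mul_vecMulVec,
        dotProduct_comm (K *ᵥ u) u, ← hqd, vecMulVec_smul]
      congr 1
      abel_nf
    rw [e, dfpFamily, ← hqd, ← hpd]
    ext i j
    simp only [hr, Matrix.add_apply, Matrix.smul_apply, Matrix.sub_apply, vecMulVec_apply,
      Pi.sub_apply, Pi.smul_apply, smul_eq_mul]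
    have h1 : t * q * (ρ / p) ^ 2 = p⁻¹ := by
      rw [div_pow, hρ]; field_simp
    linear_combination (norm := (field_simp; ring)) (-(w i * w j)) * h1
  · rw [det_smul, Fintype.card_fin, vecMulVec_eq Unit, det_one_add_replicateCol_mul_replicateRow]
    congr 1
    rw [hr, dotProduct_sub, dotProduct_smul, dotProduct_smul, dotProduct_comm u w, ← hqd]
    simp only [smul_eq_mul]
    field_simp
    ring

theorem dfpFamily_det (hn : 0 < n) (hK : K.IsSymm) (hw : 0 < w ⬝ᵥ u) (hq : 0 < u ⬝ᵥ K *ᵥ u)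
    (ht : 0 < t) :
    (dfpFamily K u w t).det = K.det * (w ⬝ᵥ u) / (u ⬝ᵥ K *ᵥ u) * t ^ (n - 1) := by
  obtain ⟨X, hX, hd⟩ := exists_dfpFamily_eq_conj hK hw hq ht
  have h1 : X.det * X.det = t ^ n * (w ⬝ᵥ u / (t * (u ⬝ᵥ K *ᵥ u))) := by
    rw [hd, mul_mul_mul_comm, ← mul_pow, Real.mul_self_sqrt ht.le,
      Real.mul_self_sqrt (by positivity)]
  have h2 : t ^ n = t ^ (n - 1) * t := by rw [← pow_succ, Nat.sub_add_cancel hn]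
  rw [hX, det_mul, det_mul, det_transpose, mul_right_comm, h1, h2]
  field_simp

theorem dfpFamily_posDef (hK : K.PosDef) (hw : 0 < w ⬝ᵥ u) (hq : 0 < u ⬝ᵥ K *ᵥ u)
    (ht : 0 < t) : (dfpFamily K u w t).PosDef := by
  have hs : K.IsSymm := by simpa [IsHermitian, IsSymm] using hK.1
  obtain ⟨X, hX, hd⟩ := exists_dfpFamily_eq_conj hs hw hq ht
  have hXu : IsUnit X := by
    rw [isUnit_iff_isUnit_det, hd, isUnit_iff_ne_zero]
    positivity
  have := hK.mul_mul_conjTranspose_same (B := X) (vecMul_injective_iff_isUnit.2 hXu)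
  rwa [conjTranspose_eq_transpose_of_trivial, ← hX] at this

/-- `K⁻¹ - t H⁻¹` is a combination of rank-one matrices having `u` as left or right factor, and
these are trace-orthogonal to a symmetric `Δ` killing `u`. This is the first-order optimality
condition along feasible directions. -/
theorem trace_dfpFamily_inv_mul (hK : K.PosDef) (hw : 0 < w ⬝ᵥ u) (hq : 0 < u ⬝ᵥ K *ᵥ u)
    (ht : 0 < t) {Δ : Matrix (Fin n) (Fin n) ℝ} (hΔ : Δ.IsSymm) (hu : Δ *ᵥ u = 0) :
    t * ((dfpFamily K u w t)⁻¹ * Δ).trace = (K⁻¹ * Δ).trace := by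
  set H := dfpFamily K u w t with hH
  have hHd : IsUnit H.det := (dfpFamily_posDef hK hw hq ht).det_pos.ne'.isUnit
  have hKd : IsUnit K.det := hK.det_pos.ne'.isUnit
  have hs : K.IsSymm := by simpa [IsHermitian, IsSymm] using hK.1
  have huK : (K *ᵥ u) ᵥ* K⁻¹ = u := by
    rw [← vecMul_transpose, hs.eq, vecMul_vecMul, mul_nonsing_inv _ hKd, vecMul_one]
  have hHw : H⁻¹ *ᵥ w = u := by
    have := dfpFamily_mulVec (t := t) hw.ne' hq.ne'
    rw [← hH] at this
    rw [← this, mulVec_mulVec, nonsing_inv_mul _ hHd, one_mulVec]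
  have huΔ : u ᵥ* Δ = 0 := by rw [← mulVec_transpose, hΔ.eq, hu]
  have e1 : H * K⁻¹ = (w ⬝ᵥ u)⁻¹ • vecMulVec w (w ᵥ* K⁻¹)
      + t • (1 - (u ⬝ᵥ K *ᵥ u)⁻¹ • vecMulVec (K *ᵥ u) u) := by
    rw [hH, dfpFamily, add_mul, smul_mul_assoc, smul_mul_assoc, sub_mul, smul_mul_assoc,
      vecMulVec_mul, vecMulVec_mul, huK, mul_nonsing_inv _ hKd]
  have e2 : K⁻¹ = (w ⬝ᵥ u)⁻¹ • vecMulVec u (w ᵥ* K⁻¹)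
      + t • (H⁻¹ - (u ⬝ᵥ K *ᵥ u)⁻¹ • vecMulVec (H⁻¹ *ᵥ K *ᵥ u) u) := by
    conv_lhs => rw [← nonsing_inv_mul_cancel_left H K⁻¹ hHd, e1]
    rw [mul_add, mul_smul_comm, mul_smul_comm, mul_sub, mul_smul_comm, mul_vecMulVec,
      mul_vecMulVec, hHw, mul_one]
  rw [e2]
  simp only [add_mul, sub_mul, smul_mul_assoc, trace_add, trace_sub, trace_smul, vecMulVec_mul,
    trace_vecMulVec, huΔ, dotProduct_zero, smul_eq_mul, mul_zero, sub_zero]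
  rw [dotProduct_comm u (_ ᵥ* Δ), ← dotProduct_mulVec, hu, dotProduct_zero, mul_zero, zero_add]

end dfpFamily

/-! ### Optimality and the influence function. -/

theorem _root_.Matrix.PosDef.isSymm {K : Matrix (Fin n) (Fin n) ℝ} (hK : K.PosDef) : K.IsSymm := by
  simpa [IsHermitian, IsSymm] using hK.1

/-- A feasible matrix for which the Bregman divergence decomposes is the unique minimizer. -/
theorem isVDFPHSolution_of_nu_eq (hV : IsPotential n V) (hn : 0 < n)
    {K : Matrix (Fin n) (Fin n) ℝ} (hK : K.PosDef) {s y ybar : Fin n → ℝ} {ε : ℝ}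
    (hw : 0 < ((1 + ε) • s) ⬝ᵥ (y + ε • ybar))
    (hq : 0 < (y + ε • ybar) ⬝ᵥ K *ᵥ (y + ε • ybar)) {t : ℝ} (ht : 0 < t)
    (hν : nu V (dfpFamily K (y + ε • ybar) ((1 + ε) • s) t).det = nu V K.det * t) :
    IsVDFPHSolution V K s y ybar ε (dfpFamily K (y + ε • ybar) ((1 + ε) • s) t) ∧
      ∀ H', IsVDFPHSolution V K s y ybar ε H' →
        H' = dfpFamily K (y + ε • ybar) ((1 + ε) • s) t := by
  set u := y + ε • ybar
  set w := (1 + ε) • s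
  set H := dfpFamily K u w t with hH
  have hHp : H.PosDef := dfpFamily_posDef hK hw hq ht
  have hHu : H *ᵥ u = w := dfpFamily_mulVec hw.ne' hq.ne'
  have key : ∀ H' : Matrix (Fin n) (Fin n) ℝ, H'.PosDef → H' *ᵥ u = w →
      vBregmanDiv V H' K = vBregmanDiv V H K + vBregmanDiv V H' H := by
    intro H' hp hu
    have h1 := trace_dfpFamily_inv_mul hK hw hq ht (hp.isSymm.sub hHp.isSymm)
      (by rw [sub_mulVec, hu, hHu, sub_self])
    rw [mul_sub, mul_sub, ← hH, nonsing_inv_mul _ hHp.det_pos.ne'.isUnit, trace_sub, trace_sub,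
      trace_one, Fintype.card_fin] at h1
    rw [vBregmanDiv_eq hV _ hK, vBregmanDiv_eq hV _ hK, vBregmanDiv_eq hV _ hHp, hν]
    linear_combination -nu V K.det * h1
  have hpos : ∀ H' : Matrix (Fin n) (Fin n) ℝ, H'.PosDef → H' *ᵥ u = w → H' ≠ H →
      vBregmanDiv V H K < vBregmanDiv V H' K := fun H' hp hu hne => by
    rw [key H' hp hu]
    linarith [vBregmanDiv_pos hV hn hp hHp hne]
  refine ⟨⟨hHp, hHu, fun H' hp hu => ?_⟩, fun H' hs => ?_⟩
  · by_cases hne : H' = H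
    · rw [hne]
    · exact (hpos H' hp hu hne).le
  · by_contra hne
    exact (hpos H' hs.posDef hs.secant hne).not_ge (hs.le_of_feasible H hHp hHu)

theorem exists_isInfluenceVDFPH (hV : IsPotential n V) (hn : 0 < n)
    {K : Matrix (Fin n) (Fin n) ℝ} (hK : K.PosDef) {s y : Fin n → ℝ} (hsy : 0 < s ⬝ᵥ y)
    (ybar : Fin n → ℝ) :
    ∃ D : Matrix (Fin n) (Fin n) ℝ, IsInfluenceVDFPH V K s y ybar D := by
  set u : ℝ → Fin n → ℝ := fun ε => y + ε • ybar with hu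
  set w : ℝ → Fin n → ℝ := fun ε => (1 + ε) • s with hw
  set p : ℝ → ℝ := fun ε => w ε ⬝ᵥ u ε with hp
  set q : ℝ → ℝ := fun ε => u ε ⬝ᵥ K *ᵥ u ε with hq
  have hud : ∀ i, Differentiable ℝ fun ε => u ε i := fun i => by
    simp only [hu, Pi.add_apply, Pi.smul_apply, smul_eq_mul]; fun_prop
  have hwd : ∀ i, Differentiable ℝ fun ε => w ε i := fun i => by
    simp only [hw, Pi.smul_apply, smul_eq_mul]; fun_prop
  have hKud : ∀ i, Differentiable ℝ fun ε => (K *ᵥ u ε) i := fun i => by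
    simp only [mulVec, dotProduct]
    exact Differentiable.fun_sum fun j _ => (hud j).const_mul _
  have hpd : Differentiable ℝ p := by
    simp only [hp, dotProduct]
    exact Differentiable.fun_sum fun j _ => (hwd j).mul (hud j)
  have hqd : Differentiable ℝ q := by
    simp only [hq, dotProduct]
    exact Differentiable.fun_sum fun j _ => (hud j).mul (hKud j)
  have hp0 : 0 < p 0 := by simpa [hp, hu, hw] using hsy
  have hq0 : 0 < q 0 := by
    have hy : y ≠ 0 := by rintro rfl; simp at hsy
    simpa [hq, hu] using hK.dotProduct_mulVec_pos hy
  have hKd := hK.det_pos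
  set c := nu V K.det with hc
  have hc0 : 0 < c := hV.nu_pos _ hKd
  -- Obtained by substituting `t = ν(z) / c` into `z = det K * p / q * t ^ (n - 1)`, the determinant
  -- of the candidate.
  set a : ℝ → ℝ := fun ε => K.det * p ε / q ε / c ^ (n - 1) with ha
  have ha0 : 0 < a 0 := by positivity
  have had : DifferentiableAt ℝ a 0 :=
    (((hpd 0).const_mul _).div (hqd 0) hq0.ne').div_const _
  obtain ⟨g, hgd, hg0, hg⟩ := hV.exists_local_solution hn ha0
  set t : ℝ → ℝ := fun ε => nu V (g (a ε)) / c with ht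
  have htd : DifferentiableAt ℝ t 0 :=
    ((hV.differentiableAt_nu hg0).comp 0 (hgd.comp 0 had)).div_const _
  set H : ℝ → Matrix (Fin n) (Fin n) ℝ := fun ε => dfpFamily K (u ε) (w ε) (t ε) with hH
  have hHd : ∀ i j, DifferentiableAt ℝ (fun ε => H ε i j) 0 := by
    intro i j
    simp only [hH, dfpFamily, Matrix.add_apply, Matrix.smul_apply, Matrix.sub_apply,
      vecMulVec_apply, smul_eq_mul]
    exact (((hpd 0).inv hp0.ne').mul ((hwd i 0).mul (hwd j 0))).add
      (htd.mul (((hqd 0).inv hq0.ne').mul ((hKud i 0).mul (hKud j 0)) |>.const_sub _))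
  refine ⟨Matrix.of fun i j => deriv (fun ε => H ε i j) 0, H, ?_, ?_⟩
  · filter_upwards [hpd.continuous.continuousAt.eventually (lt_mem_nhds hp0),
      hqd.continuous.continuousAt.eventually (lt_mem_nhds hq0),
      had.continuousAt.eventually hg] with ε h1 h2 ⟨h3, h4⟩
    have hν := hV.nu_pos _ h3
    have ht0 : 0 < t ε := div_pos hν hc0
    refine isVDFPHSolution_of_nu_eq hV hn hK h1 h2 ht0 ?_
    have h5 : g (a ε) = K.det * p ε / q ε * t ε ^ (n - 1) := by
      rw [div_eq_iff (pow_pos hν _).ne'] at h4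
      rw [ht, div_pow]
      refine h4.trans ?_
      simp only [ha]
      ring
    rw [dfpFamily_det hn hK.isSymm h1 h2 ht0]
    have h6 : nu V (g (a ε)) = c * t ε := by rw [ht]; field_simp
    rw [← h6, h5]
  · refine tendsto_pi_nhds.2 fun i => tendsto_pi_nhds.2 fun j => ?_
    simpa using (hHd i j).hasDerivAt.tendsto_slope_zero

/-- Unique optimality forces any two solution families to agree near `0`, and at `0` itself. -/
theorem IsInfluenceVDFPH.unique {K : Matrix (Fin n) (Fin n) ℝ} {s y ybar : Fin n → ℝ}
    {D D' : Matrix (Fin n) (Fin n) ℝ} (h : IsInfluenceVDFPH V K s y ybar D)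
    (h' : IsInfluenceVDFPH V K s y ybar D') : D = D' := by
  obtain ⟨H, hH, hD⟩ := h
  obtain ⟨H', hH', hD'⟩ := h'
  have he : ∀ᶠ ε in 𝓝 (0 : ℝ), H ε = H' ε := by
    filter_upwards [hH, hH'] with ε h1 h2 using h2.2 _ h1.1
  refine tendsto_nhds_unique hD (hD'.congr' ?_)
  filter_upwards [he.filter_mono nhdsWithin_le_nhds] with ε h
  rw [h, he.self_of_nhds]

/-- Differentiating the secant equation: `D y = s - H(0) ybar`. -/
theorem IsInfluenceVDFPH.mulVec_eq {K : Matrix (Fin n) (Fin n) ℝ} {s y ybar : Fin n → ℝ}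
    {D H₀ : Matrix (Fin n) (Fin n) ℝ} (h : IsInfluenceVDFPH V K s y ybar D)
    (h₀ : IsVDFPHSolution V K s y ybar 0 H₀) : D *ᵥ y = s - H₀ *ᵥ ybar := by
  obtain ⟨H, hH, hD⟩ := h
  obtain rfl : H₀ = H 0 := hH.self_of_nhds.2 _ h₀
  -- Continuity at `0` follows from convergence of the difference quotients alone.
  have hlim : Tendsto H (𝓝[≠] 0) (𝓝 (H 0)) := by
    have h1 : Tendsto (fun ε : ℝ => H 0 + ε • (ε⁻¹ • (H ε - H 0))) (𝓝[≠] 0)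
        (𝓝 (H 0 + (0 : ℝ) • D)) :=
      tendsto_const_nhds.add ((tendsto_id.mono_left nhdsWithin_le_nhds).smul hD)
    rw [zero_smul, add_zero] at h1
    refine h1.congr' ?_
    filter_upwards [self_mem_nhdsWithin] with ε hε
    rw [smul_inv_smul₀ hε, add_sub_cancel]
  have hc : ∀ v : Fin n → ℝ, Continuous fun A : Matrix (Fin n) (Fin n) ℝ => A *ᵥ v := fun v =>
    continuous_id.matrix_mulVec continuous_const
  have h2 := ((hc y).tendsto D).comp hD
  have h3 := (tendsto_const_nhds (x := s)).sub (((hc ybar).tendsto (H 0)).comp hlim)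
  refine tendsto_nhds_unique h2 (h3.congr' ?_)
  filter_upwards [self_mem_nhdsWithin, hH.filter_mono nhdsWithin_le_nhds] with ε hε h4
  have h5 := h4.1.secant
  have h6 := hH.self_of_nhds.1.secant
  rw [zero_smul, add_zero, add_zero, one_smul] at h6
  rw [mulVec_add, mulVec_smul, add_smul, one_smul] at h5
  have h7 : H ε *ᵥ y - s = ε • (s - H ε *ᵥ ybar) := by
    rw [smul_sub, sub_eq_sub_iff_add_eq_add, h5, add_comm]
  simp only [Function.comp]
  rw [smul_mulVec, sub_mulVec, h6, h7, inv_smul_smul₀ hε]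

/-! ### Unboundedness of the influence function. -/

theorem dotProduct_mulVec_le_frobNorm (D : Matrix (Fin n) (Fin n) ℝ) (v : Fin n → ℝ) :
    (D *ᵥ v) ⬝ᵥ (D *ᵥ v) ≤ frobNorm D ^ 2 * (v ⬝ᵥ v) := by
  have htr : (D * Dᵀ).trace = ∑ i, ∑ j, D i j ^ 2 := by
    simp [trace, mul_apply, pow_two]
  rw [frobNorm, Real.sq_sqrt (by rw [htr]; positivity), htr, Finset.sum_mul, dotProduct]
  refine Finset.sum_le_sum fun i _ => ?_
  have := Finset.sum_mul_sq_le_sq_mul_sq Finset.univ (fun j => D i j) v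
  simpa [mulVec, dotProduct, pow_two] using this

theorem isVDFPHSolution_self (hV : IsPotential n V) (hn : 0 < n)
    {K : Matrix (Fin n) (Fin n) ℝ} (hK : K.PosDef) {s y ybar : Fin n → ℝ} (hs : K *ᵥ y = s) :
    IsVDFPHSolution V K s y ybar 0 K := by
  refine ⟨hK, by simpa using hs, fun H' hp _ => ?_⟩
  by_cases h : H' = K
  · rw [h]
  · rw [vBregmanDiv_self]
    exact (vBregmanDiv_pos hV hn hp hK h).le

theorem sub_smul_ne_zero_of_linearIndependent {y ybar : Fin n → ℝ}
    (h : LinearIndependent ℝ ![y, ybar]) (b : ℝ) : ybar - b • y ≠ 0 := by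
  intro h0
  have := (LinearIndependent.pair_iff.1 h) (-b) 1 (by rw [← h0]; module)
  exact one_ne_zero this.2

theorem exists_influence_frobNorm_gt (hV : IsPotential n V) (hn : 0 < n) {s y ybar : Fin n → ℝ}
    (hsy : 0 < s ⬝ᵥ y) (hind : LinearIndependent ℝ ![y, ybar]) (M : ℝ) :
    ∃ K : Matrix (Fin n) (Fin n) ℝ, K.PosDef ∧
      ∃ D : Matrix (Fin n) (Fin n) ℝ, IsInfluenceVDFPH V K s y ybar D ∧ M < frobNorm D := by
  have hy : y ≠ 0 := by rintro rfl; simp at hsy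
  have hyy : 0 < y ⬝ᵥ y := by
    simpa using Matrix.PosDef.one.dotProduct_mulVec_pos hy
  set v : Fin n → ℝ := ybar - ((y ⬝ᵥ y)⁻¹ * (y ⬝ᵥ ybar)) • y with hv
  have hv0 : v ≠ 0 := sub_smul_ne_zero_of_linearIndependent hind _
  have hvv : 0 < v ⬝ᵥ v := by
    simpa using Matrix.PosDef.one.dotProduct_mulVec_pos hv0
  -- Every member satisfies the unperturbed secant equation, so `r` is free; it scales the
  -- projection onto the complement of `y`, which sends `ybar` to `v`.
  set K : ℝ → Matrix (Fin n) (Fin n) ℝ := fun r => dfpFamily 1 y s r with hKdef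
  have hq : 0 < y ⬝ᵥ (1 : Matrix (Fin n) (Fin n) ℝ) *ᵥ y := by rwa [one_mulVec]
  set b : Fin n → ℝ := s - ((s ⬝ᵥ y)⁻¹ * (s ⬝ᵥ ybar)) • s with hb
  have hK : ∀ r, s - K r *ᵥ ybar = b - r • v := by
    intro r
    simp only [hKdef, dfpFamily, add_mulVec, smul_mulVec, sub_mulVec, vecMulVec_mulVec,
      op_smul_eq_smul, smul_smul, one_mulVec, hb, hv]
    module
  have hlim : Tendsto (fun r : ℝ => (b - r • v) ⬝ᵥ (b - r • v)) atTop atTop := by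
    have e : (fun r : ℝ => (b - r • v) ⬝ᵥ (b - r • v)) =
        fun r : ℝ => b ⬝ᵥ b + r * (r * (v ⬝ᵥ v) + (-(2 * (b ⬝ᵥ v)))) := by
      funext r
      simp only [sub_dotProduct, dotProduct_sub, smul_dotProduct, dotProduct_smul, smul_eq_mul,
        dotProduct_comm v b]
      ring
    rw [e]
    exact tendsto_atTop_add_const_left _ _ (tendsto_id.atTop_mul_atTop₀
      (tendsto_atTop_add_const_right _ _ (tendsto_id.atTop_mul_const hvv)))
  obtain ⟨r, hr, hr0⟩ := ((hlim.eventually_gt_atTop (M ^ 2 * (y ⬝ᵥ y))).and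
    (eventually_gt_atTop 0)).exists
  have hKp : (K r).PosDef := dfpFamily_posDef Matrix.PosDef.one hsy hq hr0
  have hKy : K r *ᵥ y = s := dfpFamily_mulVec hsy.ne' hq.ne'
  obtain ⟨D, hD⟩ := exists_isInfluenceVDFPH hV hn hKp hsy ybar
  refine ⟨K r, hKp, D, hD, ?_⟩
  have h1 := hD.mulVec_eq (isVDFPHSolution_self hV hn hKp hKy)
  have h2 := dotProduct_mulVec_le_frobNorm D y
  rw [h1, hK] at h2
  have h3 : M ^ 2 < frobNorm D ^ 2 := lt_of_mul_lt_mul_right (hr.trans_le h2) hyy.le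
  exact lt_of_pow_lt_pow_left₀ 2 (Real.sqrt_nonneg _) h3

end QuasiNewton

end

theorem mainTheorem8 (n : ℕ) (hn : 3 ≤ n) (s y : Fin n → ℝ) (hsy : 0 < dotProduct s y)
    (𝒴 : Set (Fin n → ℝ)) (hbdd : Bornology.IsBounded 𝒴)
    (hind : ∃ ybar ∈ 𝒴, LinearIndependent ℝ ![y, ybar])
    (V : ℝ → ℝ) (hV : QuasiNewton.IsPotential n V) :
    (∀ Hk : Matrix (Fin n) (Fin n) ℝ, Hk.PosDef → ∀ ybar ∈ 𝒴,
      ∃! D : Matrix (Fin n) (Fin n) ℝ, QuasiNewton.IsInfluenceVDFPH V Hk s y ybar D) ∧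
    QuasiNewton.grossErrorSensitivityVDFPH V s y
      {Hk : Matrix (Fin n) (Fin n) ℝ | Hk.PosDef} 𝒴 = ⊤ := by
  have hn0 : 0 < n := by omega
  refine ⟨fun Hk hHk ybar _ => ?_, ?_⟩
  · obtain ⟨D, hD⟩ := QuasiNewton.exists_isInfluenceVDFPH hV hn0 hHk hsy ybar
    exact ⟨D, hD, fun D' hD' => hD'.unique hD⟩
  · obtain ⟨ybar, hyb, hli⟩ := hind
    refine EReal.eq_top_iff_forall_lt _ |>.2 fun M => ?_
    obtain ⟨K, hK, D, hD, hM⟩ := QuasiNewton.exists_influence_frobNorm_gt hV hn0 hsy hli M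
    exact (EReal.coe_lt_coe_iff.2 hM).trans_le
      (le_sSup ⟨K, hK, ybar, hyb, D, hD, rfl⟩)
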